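/- For coprime positive integers $p,q$, let $T_{p,q}$ denote the (positive) torus knot, that is, the closure of the $p$-strand braid $(\sigma_1\sigma_2\cdots\sigma_{p-1})^q$. A knot is called alternating if it has a diagram in which over- and under-crossings alternate along the knot. The alternating number $\mathrm{alt}(K)$ of a knot $K$ is the minimal number $k$ such that some diagram of $K$ becomes a diagram of an alternating knot after changing (exchanging over- and under-strand at) $k$ of its crossings. Proposition. Let $n \geq 2$ be an integer. There is a diagram of the torus knot $T_{4,2n+1}$ such that changing $n$ of its crossings yields a diagram of the connected sum $T_{2,2n+1} \,\#\, T_{2,2n+1}$. In particular, \[ \mathrm{alt}(T_{4,2n+1}) \leq n . \] -/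

import Mathlib

/-!
Link diagrams in the plane and links up to isotopy.

A diagram is taken in general position with respect to the height function of the plane and is
cut by horizontal lines into elementary pieces: a local minimum, a local maximum or a crossing of
two neighbouring strands, next to vertical strands.  Every link diagram has this form after a
planar isotopy, which does not alter its crossings.  Two diagrams represent the same link if and
only if they are related by the planar isotopy moves and the Reidemeister moves listed below.
-/

namespace KnotTheory

/-- The elementary pieces of a diagram, read from the bottom to the top: a local minimum (`cup`),
a local maximum (`cap`), and a crossing.  At `cross true` the strand from the bottom left to the
top right is the over-strand; at `cross false` it is the under-strand. -/
inductive Kind : Type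
  | cup : Kind
  | cap : Kind
  | cross (s : Bool) : Kind

/-- The number of strands that enter a piece from below. -/
def Kind.inputs : Kind → ℕ
  | .cup => 0
  | .cap => 2
  | .cross _ => 2

/-- The number of strands that leave a piece at the top. -/
def Kind.outputs : Kind → ℕ
  | .cup => 2
  | .cap => 0
  | .cross _ => 2

/-- A horizontal slice of a diagram: one elementary piece with exactly `pos` vertical strands to
its left (and any number of vertical strands to its right). -/
structure Piece : Type where
  kind : Kind
  pos : ℕ

/-- A local minimum, which creates two neighbouring strands in positions `i` and `i + 1`
(positions are counted from `0`, from left to right). -/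
def cup (i : ℕ) : Piece := ⟨.cup, i⟩

/-- A local maximum, which joins the strands in positions `i` and `i + 1`. -/
def cap (i : ℕ) : Piece := ⟨.cap, i⟩

/-- A crossing of the strands in positions `i` and `i + 1`. -/
def cross (i : ℕ) (s : Bool) : Piece := ⟨.cross s, i⟩

/-- The slices in the list, stacked from the bottom to the top, fit together to a tangle diagram
with `m` end points at the bottom and `n` end points at the top. -/
def IsTangle : List Piece → ℕ → ℕ → Prop
  | [], m, n => m = n
  | a :: w, m, n =>
      a.pos + a.kind.inputs ≤ m ∧ IsTangle w (m - a.kind.inputs + a.kind.outputs) n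

/-- An (unoriented) link diagram: a stack of slices without end points. -/
structure Diagram : Type where
  word : List Piece
  closed : IsTangle word 0 0

/-- The local moves: planar isotopies (`interchange`, `zigzag`, `slide`) and the three
Reidemeister moves (`reidemeister`). -/
inductive LocalMove : List Piece → List Piece → Prop
  /-- Two pieces that lie side by side may change their order of height. -/
  | interchange (a b : Kind) (i k : ℕ) :
      LocalMove [⟨a, i⟩, ⟨b, i + a.outputs + k⟩] [⟨b, i + a.inputs + k⟩, ⟨a, i⟩]
  /-- A local minimum and a local maximum that are adjacent on a strand cancel. -/
  | zigzag_left (i : ℕ) : LocalMove [cup i, cap (i + 1)] []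
  | zigzag_right (i : ℕ) : LocalMove [cup (i + 1), cap i] []
  /-- A crossing is turned past a local minimum: the transverse strand passes from one leg of the
  minimum to the other one, and stays above it or below it. -/
  | slide_cup (i : ℕ) (s : Bool) :
      LocalMove [cup i, cross (i + 1) s] [cup (i + 1), cross i (!s)]
  /-- The same for a local maximum. -/
  | slide_cap (i : ℕ) (s : Bool) :
      LocalMove [cross (i + 1) s, cap i] [cross i (!s), cap (i + 1)]
  /-- First Reidemeister move: a curl is removed. -/
  | reidemeister_one_cup (i : ℕ) (s : Bool) : LocalMove [cup i, cross i s] [cup i]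
  | reidemeister_one_cap (i : ℕ) (s : Bool) : LocalMove [cross i s, cap i] [cap i]
  /-- Second Reidemeister move. -/
  | reidemeister_two (i : ℕ) (s : Bool) : LocalMove [cross i s, cross i (!s)] []
  /-- Third Reidemeister move.  Of the three strands, one is on top and one is at the bottom; this
  excludes precisely the cases `s = r ≠ t`. -/
  | reidemeister_three (i : ℕ) (s t r : Bool) (h : t = s ∨ t = r) :
      LocalMove [cross i s, cross (i + 1) t, cross i r]
        [cross (i + 1) r, cross i t, cross (i + 1) s]

/-- `E` results from `D` by one local move. -/
def Move (D E : Diagram) : Prop :=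
  ∃ u l r v : List Piece, LocalMove l r ∧ D.word = u ++ l ++ v ∧ E.word = u ++ r ++ v

/-- Links up to isotopy: link diagrams modulo the equivalence relation that is generated by the
moves.  A knot is a link with one component. -/
def Link : Type := Quot Move

/-- The link that a diagram represents. -/
def Diagram.link (D : Diagram) : Link := Quot.mk Move D

/-- `ChangeCrossings k w w'`: the slices `w'` result from the slices `w` by changing exactly `k`
different crossings, that is, by exchanging the over-strand and the under-strand there. -/
inductive ChangeCrossings : ℕ → List Piece → List Piece → Prop
  | nil : ChangeCrossings 0 [] []
  | keep {k : ℕ} {w w' : List Piece} (a : Piece) :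
      ChangeCrossings k w w' → ChangeCrossings k (a :: w) (a :: w')
  | change {k : ℕ} {w w' : List Piece} (i : ℕ) (s : Bool) :
      ChangeCrossings k w w' → ChangeCrossings (k + 1) (cross i s :: w) (cross i (!s) :: w')

/-- The diagram `E` results from the diagram `D` by `k` crossing changes. -/
def Diagram.CrossingChanges (D : Diagram) (k : ℕ) (E : Diagram) : Prop :=
  ChangeCrossings k D.word E.word

/-- One slice of a labelling that witnesses that a diagram is alternating.

In an alternating diagram, each arc between two consecutive crossings is over-crossing at one of
its ends and under-crossing at the other end; direct it from the first end to the second.  The list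
of labels of a horizontal line tells for each strand that meets the line, from left to right, whether
this direction is upwards (`true`) or downwards (`false`) there.  So the two legs of a
minimum or of a maximum have opposite labels, and at a crossing the two ends of the over-strand
are directed away from the crossing and the two ends of the under-strand towards it. -/
inductive AltSlice : Piece → List Bool → List Bool → Prop
  | cup (b : Bool) (x y : List Bool) :
      AltSlice (cup x.length) (x ++ y) (x ++ [b, !b] ++ y)
  | cap (b : Bool) (x y : List Bool) :
      AltSlice (cap x.length) (x ++ [b, !b] ++ y) (x ++ y)
  /-- Over-strand from the bottom left (directed down) to the top right (directed up),
  under-strand from the bottom right (directed up) to the top left (directed down). -/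
  | cross_true (x y : List Bool) :
      AltSlice (cross x.length true) (x ++ [false, true] ++ y) (x ++ [false, true] ++ y)
  /-- Under-strand from the bottom left (directed up) to the top right (directed down),
  over-strand from the bottom right (directed down) to the top left (directed up). -/
  | cross_false (x y : List Bool) :
      AltSlice (cross x.length false) (x ++ [true, false] ++ y) (x ++ [true, false] ++ y)

/-- The slices can be labelled, with `x` on the lowest and `y` on the highest line. -/
def AltLabelled : List Piece → List Bool → List Bool → Prop
  | [], x, y => x = y
  | a :: w, x, y => ∃ z, AltSlice a x z ∧ AltLabelled w z y

/-- Alternating diagrams: along each component, over-crossings and under-crossings alternate. -/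
def Diagram.IsAlternating (D : Diagram) : Prop := AltLabelled D.word [] []

/-- A link is alternating if it has an alternating diagram. -/
def Link.IsAlternating (L : Link) : Prop := ∃ D : Diagram, D.link = L ∧ D.IsAlternating

/-- The alternating number of `L`: the least number of crossing changes that turn some diagram of
`L` into a diagram of an alternating link.  (Crossing changes keep the number of components, so
for a knot `L` the latter is a knot.)  It would be `⊤` if there were no such number. -/
noncomputable def Link.alt (L : Link) : ℕ∞ :=
  ⨅ (k : ℕ) (_ : ∃ D E : Diagram, D.link = L ∧ D.CrossingChanges k E ∧ E.link.IsAlternating),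
    (k : ℕ∞)

theorem isTangle_append (u v : List Piece) (m n : ℕ) :
    IsTangle (u ++ v) m n ↔ ∃ k, IsTangle u m k ∧ IsTangle v k n := by
  induction u generalizing m with
  | nil => simp [IsTangle]
  | cons a u ih => simp [IsTangle, ih, and_assoc]

/-- The word `(σ₀ σ₁ ⋯ σ_{p-2}) ^ q` in the standard generators of the braid group on `p`
strands. -/
def torusBraid (p q : ℕ) : List Piece :=
  (List.replicate q ((List.range (p - 1)).map fun i => cross i true)).flatten

/-- The slices of the standard closure of the braid `torusBraid p q`: `p` nested minima, the
braid on the `p` strands on the left, and `p` nested maxima. -/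
def torusWord (p q : ℕ) : List Piece :=
  (List.range p).map cup ++ torusBraid p q ++ (List.range p).reverse.map cap

theorem isTangle_cups (p : ℕ) : IsTangle ((List.range p).map cup) 0 (2 * p) := by
  induction p with
  | zero => simp [IsTangle]
  | succ p ih =>
    rw [List.range_succ, List.map_append, isTangle_append]
    refine ⟨_, ih, ?_⟩
    simp only [List.map_cons, List.map_nil, IsTangle, cup, Kind.inputs, Kind.outputs]
    omega

theorem isTangle_caps (p : ℕ) : IsTangle ((List.range p).reverse.map cap) (2 * p) 0 := by
  induction p with
  | zero => simp [IsTangle]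
  | succ p ih =>
    rw [List.range_succ, List.reverse_append]
    simp only [List.reverse_singleton, List.singleton_append, List.map_cons, IsTangle, cap,
      Kind.inputs, Kind.outputs]
    refine ⟨by omega, ?_⟩
    have h : 2 * (p + 1) - 2 + 0 = 2 * p := by omega
    rw [h]
    exact ih

theorem isTangle_crossings (l : List ℕ) (m : ℕ) (h : ∀ i ∈ l, i + 2 ≤ m) :
    IsTangle (l.map fun i => cross i true) m m := by
  induction l with
  | nil => simp [IsTangle]
  | cons i l ih =>
    have hi : i + 2 ≤ m := h i (by simp)
    simp only [List.map_cons, IsTangle, cross, Kind.inputs, Kind.outputs]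
    refine ⟨hi, ?_⟩
    have e : m - 2 + 2 = m := by omega
    rw [e]
    exact ih fun j hj => h j (by simp [hj])

theorem isTangle_torusBraid (p q : ℕ) : IsTangle (torusBraid p q) (2 * p) (2 * p) := by
  unfold torusBraid
  induction q with
  | zero => simp [IsTangle]
  | succ q ih =>
    rw [List.replicate_succ, List.flatten_cons, isTangle_append]
    refine ⟨2 * p, isTangle_crossings _ _ fun i hi => ?_, ih⟩
    have := List.mem_range.1 hi
    omega

/-- The standard diagram of the torus link `T_{p,q}`, the closure of the braid
`(σ₀ σ₁ ⋯ σ_{p-2}) ^ q`.  All its crossings are positive. -/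
def torusDiagram (p q : ℕ) : Diagram where
  word := torusWord p q
  closed := by
    rw [torusWord, isTangle_append]
    refine ⟨2 * p, ?_, isTangle_caps p⟩
    rw [isTangle_append]
    exact ⟨2 * p, isTangle_cups p, isTangle_torusBraid p q⟩

/-- The torus link `T_{p,q}`, a knot if `p` and `q` are coprime. -/
def torusLink (p q : ℕ) : Link := (torusDiagram p q).link

theorem isTangle_dropLast_append_tail {u v : List Piece} (hu : IsTangle u 0 0)
    (hv : IsTangle v 0 0) (hu0 : u ≠ []) (hv0 : v ≠ []) :
    IsTangle (u.dropLast ++ v.tail) 0 0 := by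
  rw [isTangle_append]
  refine ⟨2, ?_, ?_⟩
  · rw [← List.dropLast_append_getLast hu0, isTangle_append] at hu
    obtain ⟨k, h1, h2⟩ := hu
    generalize u.getLast hu0 = a at h2
    obtain ⟨c, i⟩ := a
    have hk : k = 2 := by
      cases c <;> simp [IsTangle, Kind.inputs, Kind.outputs] at h2
      omega
    rwa [← hk]
  · cases v with
    | nil => exact absurd rfl hv0
    | cons a v =>
      obtain ⟨c, i⟩ := a
      cases c <;> simp [IsTangle, Kind.inputs, Kind.outputs] at hv
      exact hv.2

/-- The connected sum of two diagrams: `E` is put on top of `D`, the highest piece of `D` (a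
maximum) and the lowest piece of `E` (a minimum) are removed, and the two pairs of end points that
arise are joined by vertical strands.  If one of the diagrams is empty, there is nothing to join and
the result is the other one. -/
def Diagram.connSum (D E : Diagram) : Diagram :=
  open Classical in
  if hD : D.word = [] then E
  else if hE : E.word = [] then D
  else ⟨D.word.dropLast ++ E.word.tail, isTangle_dropLast_append_tail D.closed E.closed hD hE⟩

end KnotTheory

namespace KnotTheory

/-! Write a, b, c for the generators of the braid group on four strands. The element bacb crosses
two parallel pairs of strands, so moving a letter past it exchanges a and c. Since (abc)^2 =
bacb·c^2, all these cable crossings can be collected: (abc)^(2n+1) = ab(bacb)^n a^n c^(n+1)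
(`braid_pow_odd`). The closure of the right-hand side is the required diagram of the torus knot.

Changing the first b in each of the n cable crossings makes the product telescope, b(b⁻¹acb)^n =
(ac)^n b (`mul_changed_cable_pow`). Conjugation in the closure then leaves a^k b c^k with k = 2n+1
(`closure_changed_braid`). There c^k closes up to a knotted arc, which is slid along its strand
through b and through a^k; the crossing b becomes a removable curl, and two knotted arcs in
succession remain (`closure_twists`). This is the connected sum, whose standard diagram is
alternating. -/

/-! ### The monoid of stacks up to isotopy -/

/-- Two stacks of slices are equivalent if they can be exchanged within every link diagram,
without a change of the link. -/
def isotopyCon : Con (FreeMonoid Piece) where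
  r w w' := ∀ u v : List Piece,
    -- Transitivity needs this clause: without it the middle stack might not fit where the outer two
    -- do.
    (IsTangle (u ++ (w.toList ++ v)) 0 0 ↔ IsTangle (u ++ (w'.toList ++ v)) 0 0) ∧
      ∀ h h', Diagram.link ⟨u ++ (w.toList ++ v), h⟩ = Diagram.link ⟨u ++ (w'.toList ++ v), h'⟩
  iseqv :=
    { refl := fun _ _ _ => ⟨Iff.rfl, fun _ _ => rfl⟩
      symm := fun H u v => ⟨(H u v).1.symm, fun h h' => ((H u v).2 h' h).symm⟩
      trans := fun H H' u v => ⟨(H u v).1.trans (H' u v).1, fun h h' =>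
        ((H u v).2 h ((H u v).1.1 h)).trans ((H' u v).2 ((H u v).1.1 h) h')⟩ }
  mul' := by
    intro w x y z H H' u v
    have h1 := H u (y.toList ++ v)
    have h2 := H' (u ++ x.toList) v
    simp only [FreeMonoid.toList_mul, List.append_assoc] at h1 h2 ⊢
    exact ⟨h1.1.trans h2.1, fun h h' => (h1.2 h (h1.1.1 h)).trans (h2.2 (h1.1.1 h) h')⟩

/-- Stacks of slices up to isotopy, a monoid under stacking. -/
abbrev Stack : Type := isotopyCon.Quotient

/-- The class of a stack of slices. -/
def stack (w : List Piece) : Stack := ((FreeMonoid.ofList w : FreeMonoid Piece) : Stack)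

theorem stack_append (u v : List Piece) : stack (u ++ v) = stack u * stack v := rfl

theorem stack_replicate (k : ℕ) (a : Piece) : stack (List.replicate k a) = stack [a] ^ k := by
  induction k with
  | zero => rfl
  | succ k ih => rw [List.replicate_succ', stack_append, ih, pow_succ]

theorem stack_flatten_replicate (k : ℕ) (w : List Piece) :
    stack (List.replicate k w).flatten = stack w ^ k := by
  induction k with
  | zero => rfl
  | succ k ih =>
    rw [List.replicate_succ', List.flatten_append, stack_append, ih, pow_succ]
    simp

theorem link_eq_of_stack_eq {D E : Diagram} (h : stack D.word = stack E.word) :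
    D.link = E.link := by
  have h' := ((Con.eq isotopyCon).1 h [] []).2
  obtain ⟨w, hw⟩ := D
  obtain ⟨w', hw'⟩ := E
  simp only [FreeMonoid.toList_ofList, List.nil_append, List.append_nil] at h'
  exact h' hw hw'

/-- Slices do not record the number of strands, so the two sides of a move may fit different lines.
The context `x`, `y` serves to remove this discrepancy. -/
theorem stack_eq_of_localMove {l r : List Piece} (h : LocalMove l r) (x y : List Piece)
    (H : ∀ m n, IsTangle (x ++ (l ++ y)) m n ↔ IsTangle (x ++ (r ++ y)) m n) :
    stack (x ++ (l ++ y)) = stack (x ++ (r ++ y)) := by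
  refine (Con.eq isotopyCon).2 fun u v => ?_
  simp only [FreeMonoid.toList_ofList]
  refine ⟨?_, fun h₁ h₂ => Quot.sound ⟨u ++ x, l, r, y ++ v, h, by simp, by simp⟩⟩
  rw [isTangle_append, isTangle_append]
  simp only [isTangle_append _ v, H]

/-! ### Generators and the relations given by the local moves -/

/-- The class of a local minimum. -/
def U (i : ℕ) : Stack := stack [cup i]

/-- The class of a local maximum. -/
def N (i : ℕ) : Stack := stack [cap i]

/-- The class of a crossing. -/
def X (i : ℕ) (s : Bool) : Stack := stack [cross i s]

theorem interchange (a b : Kind) {i j k : ℕ} (h : i + a.outputs ≤ j)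
    (h' : j + a.inputs = k + a.outputs) :
    stack [⟨a, i⟩] * stack [⟨b, j⟩] = stack [⟨b, k⟩] * stack [⟨a, i⟩] := by
  obtain ⟨d, rfl⟩ := Nat.exists_eq_add_of_le h
  obtain rfl : k = i + a.inputs + d := by omega
  refine stack_eq_of_localMove (.interchange a b i d) [] [] fun m n => ?_
  cases a <;> cases b <;> simp only [IsTangle, Kind.inputs, Kind.outputs, List.nil_append,
    List.cons_append] <;> (constructor <;> rintro ⟨h₁, h₂, h₃⟩ <;> omega)

theorem X_comm {i j : ℕ} (h : i + 2 ≤ j) (s t : Bool) : Commute (X i s) (X j t) :=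
  interchange (.cross s) (.cross t) h rfl

theorem U_X_right {i j : ℕ} (h : j ≤ i) (s : Bool) :
    SemiconjBy (U j) (X (i + 2) s) (X i s) :=
  interchange .cup (.cross s) (Nat.add_le_add_right h 2) rfl

theorem U_X_left {i j : ℕ} (h : i + 2 ≤ j) (s : Bool) : Commute (U j) (X i s) :=
  (interchange (.cross s) .cup h rfl).symm

theorem N_X_right {i j : ℕ} (h : j ≤ i) (s : Bool) :
    SemiconjBy (N j) (X i s) (X (i + 2) s) :=
  interchange .cap (.cross s) h rfl

theorem N_X_left {i j : ℕ} (h : i + 2 ≤ j) (s : Bool) : Commute (N j) (X i s) :=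
  (interchange (.cross s) .cap h rfl).symm

theorem U_U {i j : ℕ} (h : i ≤ j) : U i * U (j + 2) = U j * U i :=
  interchange .cup .cup (Nat.add_le_add_right h 2) rfl

theorem N_U {i j : ℕ} (h : i ≤ j) : N i * U j = U (j + 2) * N i :=
  interchange .cap .cup h rfl

theorem N_N {i j : ℕ} (h : i ≤ j) : N i * N j = N (j + 2) * N i :=
  interchange .cap .cap h rfl

theorem U_slide (i : ℕ) (s : Bool) : U i * X (i + 1) s = U (i + 1) * X i (!s) := by
  refine stack_eq_of_localMove (.slide_cup i s) [] [] fun m n => ?_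
  simp only [IsTangle, cup, cross, Kind.inputs, Kind.outputs, List.nil_append, List.cons_append]
  constructor <;> rintro ⟨h₁, h₂, h₃⟩ <;> omega

theorem slide_N (i : ℕ) (s : Bool) : X (i + 1) s * N i = X i (!s) * N (i + 1) := by
  refine stack_eq_of_localMove (.slide_cap i s) [] [] fun m n => ?_
  simp only [IsTangle, cap, cross, Kind.inputs, Kind.outputs, List.nil_append, List.cons_append]
  constructor <;> rintro ⟨h₁, h₂, h₃⟩ <;> omega

theorem X_N_curl (i : ℕ) (s : Bool) : X i s * N i = N i := by
  refine stack_eq_of_localMove (.reidemeister_one_cap i s) [] [] fun m n => ?_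
  simp only [IsTangle, cap, cross, Kind.inputs, Kind.outputs, List.nil_append, List.cons_append]
  omega

theorem X_braid (i : ℕ) (s t r : Bool) (h : t = s ∨ t = r) :
    X i s * X (i + 1) t * X i r = X (i + 1) r * X i t * X (i + 1) s := by
  refine stack_eq_of_localMove (.reidemeister_three i s t r h) [] [] fun m n => ?_
  simp only [IsTangle, cross, Kind.inputs, Kind.outputs, List.nil_append, List.cons_append]
  omega

/-- The product of the two crossings is not 1 in `Stack`, since the empty stack also fits lines with
fewer than `i + 2` strands. A neighbouring stack has to guarantee these strands. -/
theorem X_cancel_left (i : ℕ) (s : Bool) {y : List Piece}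
    (h : ∀ m n, IsTangle y m n → i + 2 ≤ m) : X i s * X i (!s) * stack y = stack y := by
  refine stack_eq_of_localMove (.reidemeister_two i s) [] y fun m n => ?_
  simp only [IsTangle, cross, Kind.inputs, Kind.outputs, List.nil_append, List.cons_append]
  refine ⟨fun ⟨h₁, _, h₃⟩ => ?_, fun H => ⟨h m n H, ?_⟩⟩
  · convert h₃ using 1; omega
  · have := h m n H
    refine ⟨by omega, ?_⟩
    convert H using 1; omega

theorem X_cancel_X {i j : ℕ} (h : i ≤ j) (s t : Bool) :
    X i s * X i (!s) * X j t = X j t :=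
  X_cancel_left i s fun m n => by
    simp only [IsTangle, cross, Kind.inputs, Kind.outputs]; omega

theorem X_cancel_N {i j : ℕ} (h : i ≤ j) (s : Bool) :
    X i s * X i (!s) * N j = N j :=
  X_cancel_left i s fun m n => by
    simp only [IsTangle, cap, Kind.inputs, Kind.outputs]; omega

theorem X_cancel_N_X (i : ℕ) (s t : Bool) :
    X (i + 2) s * X (i + 2) (!s) * (N (i + 1) * X i t) = N (i + 1) * X i t :=
  X_cancel_left (y := [cap (i + 1), cross i t]) (i + 2) s fun m n => by
    simp only [IsTangle, cap, cross, Kind.inputs, Kind.outputs]; omega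

theorem U_X_cancel {i j : ℕ} (h : j ≤ i) (s : Bool) :
    U i * (X j s * X j (!s)) = U i := by
  refine stack_eq_of_localMove (.reidemeister_two j s) [cup i] [] fun m n => ?_
  simp only [IsTangle, cup, cross, Kind.inputs, Kind.outputs, List.nil_append, List.cons_append]
  omega

theorem X_U_X_cancel (i : ℕ) (s t : Bool) :
    X i t * U (i + 1) * (X (i + 2) s * X (i + 2) (!s)) = X i t * U (i + 1) := by
  refine stack_eq_of_localMove (.reidemeister_two (i + 2) s) [cross i t, cup (i + 1)] []
    fun m n => ?_
  simp only [IsTangle, cup, cross, Kind.inputs, Kind.outputs, List.nil_append, List.cons_append]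
  omega

theorem zigzag_N (i : ℕ) : U i * N (i + 1) * N i = N i := by
  refine stack_eq_of_localMove (.zigzag_left i) [] [cap i] fun m n => ?_
  simp only [IsTangle, cup, cap, Kind.inputs, Kind.outputs, List.nil_append, List.cons_append]
  constructor <;> rintro ⟨h₁, h₂⟩ <;> simp_all; omega

/-! ### Identities for braids on four strands -/

section Braid

variable {M : Type*} [Monoid M] {a b c : M}

theorem cable_semiconj_left (hab : a * b * a = b * a * b) (hbc : b * c * b = c * b * c)
    (hac : Commute a c) : SemiconjBy (b * a * c * b) a c := by
  calc b * a * c * b * a = b * (a * c) * b * a := by simp only [mul_assoc]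
    _ = b * c * (a * b * a) := by rw [hac.eq]; simp only [mul_assoc]
    _ = (b * c * b) * a * b := by rw [hab]; simp only [mul_assoc]
    _ = c * b * (c * a) * b := by rw [hbc]; simp only [mul_assoc]
    _ = c * (b * a * c * b) := by rw [← hac.eq]; simp only [mul_assoc]

theorem cable_semiconj_right (hab : a * b * a = b * a * b) (hbc : b * c * b = c * b * c) :
    SemiconjBy (b * a * c * b) c a := by
  calc b * a * c * b * c = b * a * (c * b * c) := by simp only [mul_assoc]
    _ = (b * a * b) * c * b := by rw [← hbc]; simp only [mul_assoc]
    _ = a * (b * a * c * b) := by rw [← hab]; simp only [mul_assoc]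

theorem braid_sq (hab : a * b * a = b * a * b) (hbc : b * c * b = c * b * c)
    (hac : Commute a c) : (a * b * c) ^ 2 = b * a * c * b * c ^ 2 := by
  calc (a * b * c) ^ 2 = a * b * (c * a) * b * c := by simp only [pow_two, mul_assoc]
    _ = (a * b * a) * (c * b * c) := by rw [← hac.eq]; simp only [mul_assoc]
    _ = b * a * b * (c * b * c) := by rw [hab]
    _ = b * a * (b * c * b) * c := by simp only [mul_assoc]
    _ = b * a * c * b * c ^ 2 := by rw [hbc]; simp only [pow_two, mul_assoc]

/-- Moving the twists collected so far past one more cable crossing exchanges their exponents `n`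
and `n + 1`; the new `c ^ 2` then turns the exponent `n` of `c` into `n + 2`. -/
theorem mul_cable_pow (hab : a * b * a = b * a * b) (hbc : b * c * b = c * b * c)
    (hac : Commute a c) (n : ℕ) :
    c * (b * a * c * b * c ^ 2) ^ n = (b * a * c * b) ^ n * a ^ n * c ^ (n + 1) := by
  have h₁ := cable_semiconj_left hab hbc hac
  have h₂ := cable_semiconj_right hab hbc
  generalize b * a * c * b = x at h₁ h₂ ⊢
  induction n with
  | zero => simp
  | succ n ih =>
    calc c * (x * c ^ 2) ^ (n + 1) = c * (x * c ^ 2) ^ n * x * c ^ 2 := by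
          rw [pow_succ]; simp only [mul_assoc]
      _ = x ^ n * (a ^ n * (c ^ (n + 1) * x)) * c ^ 2 := by rw [ih]; simp only [mul_assoc]
      _ = x ^ n * (a ^ n * x) * a ^ (n + 1) * c ^ 2 := by
        rw [← (h₁.pow_right (n + 1)).eq]; simp only [mul_assoc]
      _ = x ^ (n + 1) * (c ^ n * a ^ (n + 1)) * c ^ 2 := by
        rw [← (h₂.pow_right n).eq, pow_succ x]; simp only [mul_assoc]
      _ = x ^ (n + 1) * a ^ (n + 1) * (c ^ n * c ^ 2) := by
        rw [(hac.symm.pow_pow n (n + 1)).eq]; simp only [mul_assoc]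
      _ = x ^ (n + 1) * a ^ (n + 1) * c ^ (n + 1 + 1) := by rw [← pow_add]

theorem braid_pow_odd (hab : a * b * a = b * a * b) (hbc : b * c * b = c * b * c)
    (hac : Commute a c) (n : ℕ) :
    (a * b * c) ^ (2 * n + 1) = a * b * (b * a * c * b) ^ n * a ^ n * c ^ (n + 1) := by
  rw [pow_succ', pow_mul, braid_sq hab hbc hac, mul_assoc (a * b), mul_cable_pow hab hbc hac]
  simp only [mul_assoc]

/-- The last `b` of each factor cancels the `b'` of the next one. The hypothesis stands in for `b *
b' = 1`, which is not available in `Stack`. -/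
theorem mul_changed_cable_pow {b' : M} (h : b * b' * (a * c * b) = a * c * b) (n : ℕ) :
    b * (b' * a * c * b) ^ n = (a * c) ^ n * b := by
  have : SemiconjBy b (b' * a * c * b) (a * c) := by
    simpa only [SemiconjBy, mul_assoc] using h
  exact (this.pow_right n).eq

end Braid

/-! ### Sliding a knotted arc along a strand -/

/-- The arc in position `i` with the knot that is obtained from `k` half twists. -/
def twistedArc (k i : ℕ) : Stack := U (i + 1) * X i true ^ k * N (i + 1)

/-- The transverse strand is pulled across the whole knotted arc: across its minimum, its twists and
its maximum. -/
theorem X_mul_twistedArc (k i : ℕ) (s : Bool) :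
    X i s * twistedArc k (i + 1) = twistedArc k i * X i s := by
  have hU : U (i + 1) * (X (i + 2) s * X (i + 1) s) = U (i + 2) := by
    rw [← mul_assoc, U_slide]
    have := U_X_cancel (i := i + 2) (j := i + 1) (by omega) (!s)
    rw [Bool.not_not] at this
    rw [mul_assoc]; exact this
  have hN : X (i + 2) s * X (i + 1) s * (N (i + 2) * X i s) = N (i + 1) * X i s := by
    have h := slide_N (i + 1) (!s)
    rw [Bool.not_not] at h
    rw [← mul_assoc, mul_assoc _ _ (N (i + 2)), ← h, ← X_cancel_N_X i s s]
    simp only [mul_assoc]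
  -- All three crossings have sign `s`: the transverse strand stays on one side of the others, so
  -- the third Reidemeister move is allowed for either sign.
  have hX : SemiconjBy (X (i + 2) s * X (i + 1) s * X i s) (X (i + 1) true) (X i true) := by
    have h := X_braid i true s s (.inr rfl)
    calc X (i + 2) s * X (i + 1) s * X i s * X (i + 1) true
        = X (i + 2) s * (X (i + 1) s * X i s * X (i + 1) true) := by simp only [mul_assoc]
      _ = X (i + 2) s * X i true * (X (i + 1) s * X i s) := by rw [← h]; simp only [mul_assoc]
      _ = X i true * (X (i + 2) s * X (i + 1) s * X i s) := by
        rw [← (X_comm (le_refl (i + 2)) true s).eq]; simp only [mul_assoc]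
  calc X i s * twistedArc k (i + 1)
      = X i s * U (i + 2) * X (i + 1) true ^ k * N (i + 2) := by
        simp only [twistedArc, mul_assoc]
    _ = U (i + 2) * (X i s * X (i + 1) true ^ k) * N (i + 2) := by
        rw [← (U_X_left (le_refl (i + 2)) s).eq]; simp only [mul_assoc]
    _ = U (i + 1) * (X (i + 2) s * X (i + 1) s * X i s * X (i + 1) true ^ k) * N (i + 2) := by
        rw [← hU]; simp only [mul_assoc]
    _ = U (i + 1) * X i true ^ k * (X (i + 2) s * X (i + 1) s * (X i s * N (i + 2))) := by
        rw [(hX.pow_right k).eq]; simp only [mul_assoc]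
    _ = U (i + 1) * X i true ^ k * (N (i + 1) * X i s) := by
        rw [← (N_X_left (le_refl (i + 2)) s).eq, hN]
    _ = twistedArc k i * X i s := by simp only [twistedArc, mul_assoc]

theorem X_mul_twistedArc' (k i : ℕ) (s : Bool) :
    X i s * twistedArc k i = twistedArc k (i + 1) * X i s := by
  -- The factor `X i s` is kept on both sides because it guarantees the strands needed for the
  -- cancellation.
  have hU : X i s * U (i + 1) = X i s * (U (i + 2) * (X (i + 1) s * X (i + 2) s)) := by
    have h := U_slide (i + 1) (!s)
    rw [Bool.not_not] at h
    have h' := X_U_X_cancel i (!s) s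
    rw [Bool.not_not] at h'
    rw [← h', ← mul_assoc (U (i + 2)), ← h]
    simp only [mul_assoc]
  have hN : X (i + 1) s * X (i + 2) s * N (i + 1) = N (i + 2) := by
    rw [mul_assoc, slide_N, ← mul_assoc, X_cancel_N (by omega)]
  have hX : SemiconjBy (X i s * X (i + 1) s * X (i + 2) s) (X i true) (X (i + 1) true) := by
    have h := X_braid i s s true (.inl rfl)
    calc X i s * X (i + 1) s * X (i + 2) s * X i true
        = X i s * X (i + 1) s * (X i true * X (i + 2) s) := by
          rw [(X_comm (le_refl (i + 2)) true s).eq]; simp only [mul_assoc]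
      _ = X i s * X (i + 1) s * X i true * X (i + 2) s := by simp only [mul_assoc]
      _ = X (i + 1) true * (X i s * X (i + 1) s * X (i + 2) s) := by
        rw [h]; simp only [mul_assoc]
  calc X i s * twistedArc k i
      = X i s * U (i + 1) * X i true ^ k * N (i + 1) := by simp only [twistedArc, mul_assoc]
    _ = X i s * U (i + 2) * (X (i + 1) s * X (i + 2) s) * X i true ^ k * N (i + 1) := by
        rw [hU]; simp only [mul_assoc]
    _ = U (i + 2) * (X i s * X (i + 1) s * X (i + 2) s * X i true ^ k) * N (i + 1) := by
        rw [← (U_X_left (le_refl (i + 2)) s).eq]; simp only [mul_assoc]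
    _ = U (i + 2) * X (i + 1) true ^ k * (X i s * (X (i + 1) s * X (i + 2) s * N (i + 1))) := by
        rw [(hX.pow_right k).eq]; simp only [mul_assoc]
    _ = U (i + 2) * X (i + 1) true ^ k * (N (i + 2) * X i s) := by
        rw [hN, (N_X_left (le_refl (i + 2)) s).eq]
    _ = twistedArc k (i + 1) * X i s := by simp only [twistedArc, mul_assoc]

/-- Two crossings bring the arc back to its position, so an even power commutes with it; the
remaining crossing shifts it by one. -/
theorem X_pow_odd_mul_twistedArc (k n i : ℕ) (s : Bool) :
    X i s ^ (2 * n + 1) * twistedArc k (i + 1) = twistedArc k i * X i s ^ (2 * n + 1) := by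
  have h : Commute (X i s ^ 2) (twistedArc k (i + 1)) := by
    rw [Commute, SemiconjBy, pow_two, mul_assoc, X_mul_twistedArc, ← mul_assoc,
      X_mul_twistedArc', mul_assoc]
  rw [pow_succ', pow_mul, mul_assoc, (h.pow_left n).eq, ← mul_assoc, X_mul_twistedArc, mul_assoc]

/-- A local minimum moves upwards past an arc on its left. -/
theorem U_mul_twistedArc (k i : ℕ) :
    U (i + 1) * twistedArc k i = twistedArc k i * U (i + 1) := by
  calc U (i + 1) * twistedArc k i
      = U (i + 1) * U (i + 1) * X i true ^ k * N (i + 1) := by simp only [twistedArc, mul_assoc]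
    _ = U (i + 1) * (U (i + 3) * X i true ^ k) * N (i + 1) := by
        rw [← U_U le_rfl]; simp only [mul_assoc]
    _ = U (i + 1) * X i true ^ k * (U (i + 3) * N (i + 1)) := by
        rw [((U_X_left (by omega : i + 2 ≤ i + 3) true).pow_right k).eq]; simp only [mul_assoc]
    _ = twistedArc k i * U (i + 1) := by
        rw [← N_U le_rfl]; simp only [twistedArc, mul_assoc]

/-! ### Closures of braids and conjugation -/

/-- A crossing travels around two nested minima. Its sign is flipped by each of the two slides and
so is preserved. -/
theorem U_U_X (i : ℕ) (s : Bool) :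
    U i * U (i + 1) * X i s = U i * U (i + 1) * X (i + 2) s := by
  have h := U_slide i (!s)
  rw [Bool.not_not] at h
  rw [mul_assoc, ← h, ← mul_assoc, ← U_U le_rfl, mul_assoc, ← U_slide, ← mul_assoc]

theorem X_N_N (i : ℕ) (s : Bool) :
    X i s * (N (i + 1) * N i) = X (i + 2) s * (N (i + 1) * N i) := by
  have h := slide_N i (!s)
  rw [Bool.not_not] at h
  rw [← mul_assoc, ← h, mul_assoc, N_N le_rfl, ← mul_assoc, ← slide_N, mul_assoc]

/-- Four nested minima. -/
def cups : Stack := U 0 * U 1 * U 2 * U 3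

/-- Four nested maxima. -/
def caps : Stack := N 3 * N 2 * N 1 * N 0

/-- The closure of a braid with four strands. -/
def closure (w : Stack) : Stack := cups * w * caps

theorem cups_X_zero (s : Bool) : cups * X 0 s = cups * X 6 s := by
  calc cups * X 0 s = U 0 * U 1 * (U 2 * (U 3 * X 0 s)) := by simp only [cups, mul_assoc]
    _ = U 0 * U 1 * X 0 s * U 2 * U 3 := by
      rw [(U_X_left (by omega) s).eq, ← mul_assoc (U 2), (U_X_left (by omega) s).eq]
      simp only [mul_assoc]
    _ = U 0 * U 1 * (X 2 s * U 2) * U 3 := by rw [U_U_X]; simp only [mul_assoc]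
    _ = U 0 * U 1 * U 2 * (X 4 s * U 3) := by
      rw [← (U_X_right (le_refl 2) s).eq]; simp only [mul_assoc]
    _ = cups * X 6 s := by
      rw [← (U_X_right (by omega : 3 ≤ 4) s).eq]; simp only [cups, mul_assoc]

theorem cups_X_two (s : Bool) : cups * X 2 s = cups * X 4 s := by
  have h := congrArg (U 0 * U 1 * ·) (U_U_X 2 s)
  simpa only [cups, mul_assoc] using h

theorem X_zero_caps (s : Bool) : X 0 s * caps = X 6 s * caps := by
  symm
  calc X 6 s * caps = X 6 s * N 3 * N 2 * N 1 * N 0 := by simp only [caps, mul_assoc]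
    _ = N 3 * (X 4 s * N 2) * N 1 * N 0 := by
      rw [← (N_X_right (by omega : 3 ≤ 4) s).eq]; simp only [mul_assoc]
    _ = N 3 * N 2 * (X 2 s * (N 1 * N 0)) := by
      rw [← (N_X_right (le_refl 2) s).eq]; simp only [mul_assoc]
    _ = N 3 * (N 2 * X 0 s) * N 1 * N 0 := by rw [← X_N_N 0]; simp only [mul_assoc]
    _ = N 3 * X 0 s * N 2 * N 1 * N 0 := by
      rw [(N_X_left (by omega) s).eq]; simp only [mul_assoc]
    _ = X 0 s * caps := by
      rw [(N_X_left (by omega) s).eq]; simp only [caps, mul_assoc]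

theorem X_two_caps (s : Bool) : X 2 s * caps = X 4 s * caps := by
  have h := congrArg (· * (N 1 * N 0)) (X_N_N 2 s)
  simpa only [caps, mul_assoc] using h

/-- This is conjugation without inverses: `x` travels through the minima to its mirror position `y`
on the closing strands, passes beside `w`, and returns through the maxima. -/
theorem closure_mul_comm {w x y : Stack} (h₁ : cups * x = cups * y) (h₂ : x * caps = y * caps)
    (hxy : Commute x y) (hw : Commute y w) (k : ℕ) :
    closure (x ^ k * w) = closure (w * x ^ k) := by
  have h₁' : cups * x ^ k = cups * y ^ k := by
    clear h₂
    induction k with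
    | zero => simp
    | succ k ih =>
      rw [pow_succ, ← mul_assoc, ih, mul_assoc, ← (hxy.pow_right k).eq, ← mul_assoc, h₁,
        mul_assoc, ← pow_succ']
  have h₂' : x ^ k * caps = y ^ k * caps := by
    clear h₁ h₁'
    induction k with
    | zero => simp
    | succ k ih =>
      rw [pow_succ', mul_assoc, ih, ← mul_assoc, (hxy.pow_right k).eq, mul_assoc, h₂,
        ← mul_assoc, ← pow_succ]
  calc closure (x ^ k * w) = cups * x ^ k * w * caps := by simp only [closure, mul_assoc]
    _ = cups * (y ^ k * w) * caps := by rw [h₁']; simp only [mul_assoc]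
    _ = cups * w * (y ^ k * caps) := by rw [(hw.pow_left k).eq]; simp only [mul_assoc]
    _ = closure (w * x ^ k) := by rw [← h₂']; simp only [closure, mul_assoc]

theorem closure_X_zero_comm {w : Stack} (hw : Commute (X 6 true) w) (k : ℕ) :
    closure (X 0 true ^ k * w) = closure (w * X 0 true ^ k) :=
  closure_mul_comm (cups_X_zero _) (X_zero_caps _) (X_comm (by omega) _ _) hw k

theorem closure_X_two_comm {w : Stack} (hw : Commute (X 4 true) w) (k : ℕ) :
    closure (X 2 true ^ k * w) = closure (w * X 2 true ^ k) :=
  closure_mul_comm (cups_X_two _) (X_two_caps _) (X_comm (by omega) _ _) hw k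

/-! ### The closed braid as a connected sum -/

/-- A Markov destabilisation: the crossing slides into a curl on the maximum, and the remaining
zigzag is straightened. -/
theorem U_X_N (s : Bool) : U 2 * X 1 s * N 2 * N 1 = N 1 := by
  have h := U_slide 1 (!s)
  rw [Bool.not_not] at h
  rw [← h, mul_assoc (U 1), X_N_curl, zigzag_N]

/-- The closure of `σ₀ ^ k * σ₁ * σ₂ ^ k` for odd `k` is a connected sum. -/
theorem closure_twists (n : ℕ) :
    closure (X 0 true ^ (2 * n + 1) * X 1 true * X 2 true ^ (2 * n + 1)) =
      U 0 * twistedArc (2 * n + 1) 0 * twistedArc (2 * n + 1) 0 * N 0 := by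
  have hX := X_pow_odd_mul_twistedArc (2 * n + 1) n 0 true
  set k := 2 * n + 1
  have h₂ := ((U_X_left (by omega : 0 + 2 ≤ 2) true).pow_right k).eq
  have h₃ := ((U_X_left (by omega : 0 + 2 ≤ 3) true).pow_right k).eq
  have h₃' := (U_X_left (by omega : 1 + 2 ≤ 3) true).eq
  calc closure (X 0 true ^ k * X 1 true * X 2 true ^ k)
      = U 0 * U 1 * U 2 * (U 3 * X 0 true ^ k) * X 1 true * X 2 true ^ k * N 3 * N 2 * N 1 * N 0 := by
        simp only [closure, cups, caps, mul_assoc]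
    _ = U 0 * U 1 * (U 2 * X 0 true ^ k) * (U 3 * X 1 true) * X 2 true ^ k * N 3 * N 2 * N 1 * N 0 := by
        rw [h₃]; simp only [mul_assoc]
    -- The innermost closing arc turns the twists of the last two strands into a knotted arc.
    _ = U 0 * U 1 * X 0 true ^ k * U 2 * (X 1 true * twistedArc k 2) * N 2 * N 1 * N 0 := by
        rw [h₂, h₃']; simp only [twistedArc, mul_assoc]
    _ = U 0 * U 1 * X 0 true ^ k * (U 2 * twistedArc k 1) * X 1 true * N 2 * N 1 * N 0 := by
        rw [X_mul_twistedArc]; simp only [mul_assoc]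
    _ = U 0 * U 1 * (X 0 true ^ k * twistedArc k 1) * (U 2 * X 1 true * N 2 * N 1) * N 0 := by
        rw [U_mul_twistedArc]; simp only [mul_assoc]
    -- The exponent `k` is odd, so the knotted arc leaves the twist region on the other strand.
    _ = U 0 * (U 1 * twistedArc k 0) * X 0 true ^ k * N 1 * N 0 := by
        rw [hX, U_X_N]; simp only [mul_assoc]
    -- Once the first arc is below `U 1`, the remaining twists between `U 1` and `N 1` form the
    -- second one.
    _ = U 0 * twistedArc k 0 * twistedArc k 0 * N 0 := by
        rw [U_mul_twistedArc]; simp only [twistedArc, mul_assoc]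

/-! ### The torus knot and the changed braid -/

theorem stack_torusWord_four (n : ℕ) :
    stack (torusWord 4 (2 * n + 1)) = closure (X 0 true * X 1 true *
      (X 1 true * X 0 true * X 2 true * X 1 true) ^ n * X 0 true ^ n * X 2 true ^ (n + 1)) := by
  rw [← braid_pow_odd (X_braid 0 true true true (.inl rfl)) (X_braid 1 true true true (.inl rfl))
    (X_comm (by omega) _ _), torusWord, torusBraid, stack_append, stack_append,
    stack_flatten_replicate]
  rfl

theorem X_comm_of_le {i : ℕ} (h : 4 ≤ i) : Commute (X i true) (X 0 true) ∧
    Commute (X i true) (X 1 true) ∧ Commute (X i true) (X 2 true) :=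
  ⟨(X_comm (by omega) _ _).symm, (X_comm (by omega) _ _).symm, (X_comm (by omega) _ _).symm⟩

/-- After `n` crossing changes, the braid can be conjugated to `σ₀ ^ k * σ₁ * σ₂ ^ k`. -/
theorem closure_changed_braid (n : ℕ) :
    closure (X 0 true * X 1 true *
      (X 1 false * X 0 true * X 2 true * X 1 true) ^ n * X 0 true ^ n * X 2 true ^ (n + 1)) =
    closure (X 0 true ^ (2 * n + 1) * X 1 true * X 2 true ^ (2 * n + 1)) := by
  have hac : Commute (X 0 true) (X 2 true) := X_comm (by omega) _ _
  -- The crossing `X 2 true`, moved to the front of the trailing factor, supplies the strands for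
  -- the cancellation.
  have h : X 1 true * X 1 false * (X 0 true * X 2 true * X 1 true) =
      X 0 true * X 2 true * X 1 true := by
    rw [hac.eq, mul_assoc (X 2 true), ← mul_assoc (X 1 true * X 1 false)]
    rw [show X 1 true * X 1 false * X 2 true = X 2 true from X_cancel_X (by omega) true true]
  have hb := mul_changed_cable_pow h n
  have h₄ := closure_X_two_comm (w := X 0 true ^ (n + 1) * X 1 true * X 0 true ^ n *
    X 2 true ^ (n + 1)) (by
      obtain ⟨h₁, h₂, h₃⟩ := X_comm_of_le (le_refl 4)
      exact (((h₁.pow_right _).mul_right h₂).mul_right (h₁.pow_right _)).mul_right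
        (h₃.pow_right _)) n
  have h₆ := closure_X_zero_comm (w := X 0 true ^ (n + 1) * X 1 true *
    X 2 true ^ (2 * n + 1)) (by
      obtain ⟨h₁, h₂, h₃⟩ := X_comm_of_le (by omega : 4 ≤ 6)
      exact ((h₁.pow_right _).mul_right h₂).mul_right (h₃.pow_right _)) n
  have hn : n + 1 + n = 2 * n + 1 := by omega
  have hn' : n + (n + 1) = 2 * n + 1 := by omega
  calc _ = closure (X 0 true * (X 1 true * (X 1 false * X 0 true * X 2 true * X 1 true) ^ n) *
        X 0 true ^ n * X 2 true ^ (n + 1)) := by simp only [mul_assoc]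
    _ = closure (X 2 true ^ n * (X 0 true ^ (n + 1) * X 1 true * X 0 true ^ n *
        X 2 true ^ (n + 1))) := by
      rw [hb, hac.mul_pow, pow_succ' (X 0 true), ← mul_assoc (X 0 true), ← mul_assoc (X 0 true),
        ← pow_succ', (hac.pow_pow (n + 1) n).eq, pow_succ' (X 0 true)]
      simp only [mul_assoc]
    _ = closure (X 0 true ^ (n + 1) * X 1 true * X 0 true ^ n *
        (X 2 true ^ (n + 1) * X 2 true ^ n)) := by rw [h₄, mul_assoc]
    _ = closure (X 0 true ^ (n + 1) * X 1 true * X 2 true ^ (2 * n + 1) * X 0 true ^ n) := by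
      rw [← pow_add, hn, mul_assoc _ (X 0 true ^ n), (hac.pow_pow n _).eq, mul_assoc _ _ (_ ^ n)]
    _ = closure (X 0 true ^ n * X 0 true ^ (n + 1) * X 1 true * X 2 true ^ (2 * n + 1)) := by
      rw [← h₆]; simp only [mul_assoc]
    _ = _ := by rw [← pow_add, hn']

/-! ### The explicit diagrams and their crossing changes -/

/-- The slices of the closure of the braid `σ₀ σ₁ (σ₁ ^ ± σ₀ σ₂ σ₁) ^ n σ₀ ^ n σ₂ ^ (n + 1)`. -/
def cableWord (s : Bool) (n : ℕ) : List Piece :=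
  [cup 0, cup 1, cup 2, cup 3, cross 0 true, cross 1 true] ++
    (List.replicate n [cross 1 s, cross 0 true, cross 2 true, cross 1 true]).flatten ++
    List.replicate n (cross 0 true) ++ List.replicate (n + 1) (cross 2 true) ++
    [cap 3, cap 2, cap 1, cap 0]

theorem stack_cableWord (s : Bool) (n : ℕ) :
    stack (cableWord s n) = closure (X 0 true * X 1 true *
      (X 1 s * X 0 true * X 2 true * X 1 true) ^ n * X 0 true ^ n * X 2 true ^ (n + 1)) := by
  simp only [cableWord, stack_append, stack_flatten_replicate, stack_replicate]
  simp only [closure, cups, caps, mul_assoc]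
  rfl

theorem isTangle_replicate_cross {i m : ℕ} (h : i + 2 ≤ m) (s : Bool) (k : ℕ) :
    IsTangle (List.replicate k (cross i s)) m m := by
  induction k with
  | zero => rfl
  | succ k ih =>
    refine ⟨h, ?_⟩
    convert ih using 1
    simp only [cross, Kind.inputs, Kind.outputs] at h ⊢
    omega

theorem isTangle_flatten_replicate {w : List Piece} {m : ℕ} (h : IsTangle w m m) (k : ℕ) :
    IsTangle (List.replicate k w).flatten m m := by
  induction k with
  | zero => rfl
  | succ k ih =>
    rw [List.replicate_succ, List.flatten_cons, isTangle_append]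
    exact ⟨m, h, ih⟩

theorem isTangle_cableWord (s : Bool) (n : ℕ) : IsTangle (cableWord s n) 0 0 := by
  simp only [cableWord, isTangle_append]
  refine ⟨8, ⟨8, ⟨8, ⟨8, ?_, isTangle_flatten_replicate ?_ n⟩,
    isTangle_replicate_cross (by omega) _ _⟩, isTangle_replicate_cross (by omega) _ _⟩, ?_⟩ <;>
  simp [IsTangle, cup, cap, cross, Kind.inputs, Kind.outputs]

/-- The closure of the braid `σ₀ σ₁ (σ₁ ^ ± σ₀ σ₂ σ₁) ^ n σ₀ ^ n σ₂ ^ (n + 1)`. -/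
def cableDiagram (s : Bool) (n : ℕ) : Diagram := ⟨cableWord s n, isTangle_cableWord s n⟩

theorem ChangeCrossings.refl (w : List Piece) : ChangeCrossings 0 w w := by
  induction w with
  | nil => exact .nil
  | cons a w ih => exact .keep a ih

/-- With the count in the order `k + j`, every case of the induction on the first stack holds by
definition. -/
theorem ChangeCrossings.append {j k : ℕ} {u u' v v' : List Piece} (h : ChangeCrossings j u u')
    (h' : ChangeCrossings k v v') : ChangeCrossings (k + j) (u ++ v) (u' ++ v') := by
  induction h with
  | nil => exact h'
  | keep a _ ih => exact .keep a ih
  | change i s _ ih => exact .change i s ih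

theorem ChangeCrossings.flatten_replicate {u u' : List Piece} (h : ChangeCrossings 1 u u')
    (n : ℕ) :
    ChangeCrossings n (List.replicate n u).flatten (List.replicate n u').flatten := by
  induction n with
  | zero => exact .nil
  | succ n ih => exact h.append ih

theorem cableDiagram_crossingChanges (n : ℕ) :
    (cableDiagram true n).CrossingChanges n (cableDiagram false n) := by
  have h : ChangeCrossings 1 [cross 1 true, cross 0 true, cross 2 true, cross 1 true]
    [cross 1 false, cross 0 true, cross 2 true, cross 1 true] := .change 1 true (.refl _)
  have h' : ChangeCrossings (0 + (0 + (0 + (n + 0)))) (cableWord true n) (cableWord false n) :=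
    ((((ChangeCrossings.refl _).append (h.flatten_replicate n)).append (.refl _)).append
    (.refl _)).append (.refl _)
  simpa [Diagram.CrossingChanges, cableDiagram] using h'

theorem torusWord_two (k : ℕ) :
    torusWord 2 k = [cup 0, cup 1] ++ List.replicate k (cross 0 true) ++ [cap 1, cap 0] := by
  have h : torusBraid 2 k = List.replicate k (cross 0 true) := by
    simp [torusBraid, List.range_succ]
  rw [torusWord, h]
  rfl

theorem connSum_torusDiagram_two_word (k l : ℕ) :
    ((torusDiagram 2 k).connSum (torusDiagram 2 l)).word =
      [cup 0, cup 1] ++ List.replicate k (cross 0 true) ++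
        [cap 1, cup 1] ++ List.replicate l (cross 0 true) ++ [cap 1, cap 0] := by
  have h : ∀ k, (torusDiagram 2 k).word ≠ [] := fun k => by
    simp [torusDiagram, torusWord_two]
  rw [Diagram.connSum, dif_neg (h k), dif_neg (h l)]
  simp only [torusDiagram, torusWord_two]
  rw [List.dropLast_append_of_ne_nil (by simp)]
  simp

theorem stack_connSum (k : ℕ) :
    stack ((torusDiagram 2 k).connSum (torusDiagram 2 k)).word =
      U 0 * twistedArc k 0 * twistedArc k 0 * N 0 := by
  rw [connSum_torusDiagram_two_word]
  simp only [stack_append, stack_replicate, twistedArc, mul_assoc]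
  rfl

/-! ### The connected sum is alternating -/

theorem altLabelled_append {u v : List Piece} {x y z : List Bool} (hu : AltLabelled u x y)
    (hv : AltLabelled v y z) : AltLabelled (u ++ v) x z := by
  induction u generalizing x with
  | nil => obtain rfl : x = y := hu; exact hv
  | cons a u ih =>
    obtain ⟨t, ha, hu⟩ := hu
    exact ⟨t, ha, ih hu⟩

theorem altLabelled_replicate {a : Piece} {x : List Bool} (h : AltSlice a x x) (k : ℕ) :
    AltLabelled (List.replicate k a) x x := by
  induction k with
  | zero => rfl
  | succ k ih => exact ⟨x, h, ih⟩

theorem isAlternating_connSum (k l : ℕ) :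
    ((torusDiagram 2 k).connSum (torusDiagram 2 l)).IsAlternating := by
  rw [Diagram.IsAlternating, connSum_torusDiagram_two_word]
  -- This line of labels is unchanged by the crossing, so it serves throughout both twist regions.
  have hc : AltSlice (cross 0 true) [false, true, false, true] [false, true, false, true] :=
    .cross_true [] [false, true]
  have h₀ : AltSlice (cup 0) [] [false, true] := .cup false [] []
  have h₁ : AltSlice (cup 1) [false, true] [false, true, false, true] := .cup true [false] [true]
  have h₂ : AltSlice (cap 1) [false, true, false, true] [false, true] := .cap true [false] [true]
  have h₃ : AltSlice (cap 0) [false, true] [] := .cap false [] []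
  exact altLabelled_append (altLabelled_append (altLabelled_append (altLabelled_append
    ⟨_, h₀, _, h₁, rfl⟩ (altLabelled_replicate hc k)) ⟨_, h₂, _, h₁, rfl⟩)
    (altLabelled_replicate hc l)) ⟨_, h₂, _, h₃, rfl⟩

end KnotTheory

theorem mainTheorem4 (n : ℕ) (hn : 2 ≤ n) :
    (∃ D E : KnotTheory.Diagram,
      D.link = KnotTheory.torusLink 4 (2 * n + 1) ∧
      D.CrossingChanges n E ∧
      E.link = ((KnotTheory.torusDiagram 2 (2 * n + 1)).connSum
        (KnotTheory.torusDiagram 2 (2 * n + 1))).link) ∧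
    (KnotTheory.torusLink 4 (2 * n + 1)).alt ≤ (n : ℕ∞) := by
  have hD : (KnotTheory.cableDiagram true n).link = KnotTheory.torusLink 4 (2 * n + 1) :=
    KnotTheory.link_eq_of_stack_eq
      ((KnotTheory.stack_cableWord true n).trans (KnotTheory.stack_torusWord_four n).symm)
  have hE : (KnotTheory.cableDiagram false n).link =
      ((KnotTheory.torusDiagram 2 (2 * n + 1)).connSum
        (KnotTheory.torusDiagram 2 (2 * n + 1))).link := by
    refine KnotTheory.link_eq_of_stack_eq ((KnotTheory.stack_cableWord false n).trans ?_)
    rw [KnotTheory.closure_changed_braid, KnotTheory.closure_twists, KnotTheory.stack_connSum]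
  have hDE := KnotTheory.cableDiagram_crossingChanges n
  exact ⟨⟨_, _, hD, hDE, hE⟩, iInf₂_le n
    ⟨_, _, hD, hDE, _, hE.symm, KnotTheory.isAlternating_connSum _ _⟩⟩
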